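/- For a set $S\subset\mathbb{R}_{\ge 0}^2$, the Newton diagram supported by $S$ is the convex hull of $\bigcup_{P\in S}(P+\mathbb{R}_{\ge 0}^2)$. If a diagram $\Gamma$ meets the axes first at $(p,0)$ and $(0,q)$, its Newton number is $\nu(\Gamma)=2A-p-q+1$, where $A$ is the area of $\mathbb{R}_{\ge 0}^2\setminus\Gamma$. A deformation of $\Gamma$ is a diagram supported by $\Gamma\cup\{P_1,\dots,P_n\}$ with $n\ge 0$ and $P_i\in\mathbb{Z}_{\ge 0}^2\setminus\{(0,0)\}$. Let $\nu_0>\nu_1>\dots>\nu_s$ be all the positive integers that are Newton numbers of deformations of $\Gamma$; the sequence $(\nu_{i-1}-\nu_i)_{i=1,\dots,s}$ is called the sequence of minimal jumps of Newton numbers of $\Gamma$. Theorem. Let $1<a_0<b_0$ be coprime integers, let $\triangle(a_0,b_0)$ be the Newton diagram supported by $\{(a_0,0),(0,b_0)\}$, and let $r$ be the remainder of $b_0$ on division by $a_0$. Then the set of positive integers attained as Newton numbers of deformations of $\triangle(a_0,b_0)$ is finite with largest element $\nu_0=\nu(\triangle(a_0,b_0))$, and the sequence of minimal jumps of Newton numbers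 of $\triangle(a_0,b_0)$ begins with $$\underbrace{1,\dots,1}_{r(a_0-r)}.$$ Equivalently, every integer $k$ with $\nu(\triangle(a_0,b_0))-r(a_0-r)\le k\le\nu(\triangle(a_0,b_0))$ is the Newton number of some deformation of $\triangle(a_0,b_0)$. -/

import Mathlib

namespace NewtonJumps

/-- The closed first quadrant of the real plane. -/
def quadrant : Set (ℝ × ℝ) := {z | 0 ≤ z.1 ∧ 0 ≤ z.2}

/-- A lattice point with nonnegative coordinates, seen in the real plane. -/
def latticePoint (P : ℕ × ℕ) : ℝ × ℝ := ((P.1 : ℝ), (P.2 : ℝ))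

/-- The Newton diagram of (supported by) a set `S` of points: the convex hull of the union of the
translated quadrants `P + ℝ₊²`, `P ∈ S`. -/
def newtonDiagram (S : Set (ℝ × ℝ)) : Set (ℝ × ℝ) :=
  convexHull ℝ (⋃ P ∈ S, (fun z => P + z) '' quadrant)

/-- The diagram `△(a, b)` whose only compact edge is the segment from `(a, 0)` to `(0, b)`. -/
def triangle (a b : ℕ) : Set (ℝ × ℝ) :=
  newtonDiagram {latticePoint (a, 0), latticePoint (0, b)}

/-- `Γ + (P₁, …, Pₙ)`: the smallest diagram containing `Γ` and the points `P₁, …, Pₙ` of `T`. -/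
def addPoints (Γ : Set (ℝ × ℝ)) (T : Finset (ℕ × ℕ)) : Set (ℝ × ℝ) :=
  newtonDiagram (Γ ∪ latticePoint '' (T : Set (ℕ × ℕ)))

/-- `Δ` is a deformation of the diagram `Γ`: it arises by adding finitely many (possibly no)
lattice points of the quadrant. The origin is not allowed: the Newton number refers to
the nonzero coordinates of the intersections of the diagram with the axes. -/
def IsDeformation (Γ Δ : Set (ℝ × ℝ)) : Prop :=
  ∃ T : Finset (ℕ × ℕ), (0, 0) ∉ T ∧ Δ = addPoints Γ T

/-- The Newton number `2A - p - q + 1` of a diagram that meets both axes, where `A` is the area of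
the complement of the diagram in the quadrant and `(p, 0)`, `(0, q)` are the points where the
boundary of the diagram leaves the axes. -/
noncomputable def newtonNumber (Γ : Set (ℝ × ℝ)) : ℝ :=
  2 * (MeasureTheory.volume (quadrant \ Γ)).toReal
    - sInf {x : ℝ | (x, (0 : ℝ)) ∈ Γ} - sInf {y : ℝ | ((0 : ℝ), y) ∈ Γ} + 1

/-- The positive integers attained as Newton numbers of deformations of `Γ`. -/
def attainedNumbers (Γ : Set (ℝ × ℝ)) : Set ℤ :=
  {k | 0 < k ∧ ∃ Δ, IsDeformation Γ Δ ∧ newtonNumber Δ = (k : ℝ)}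

/-- `l` is the strictly decreasing (finite) sequence `ν₀ > ν₁ > … > νₛ` of all positive integers
attained as Newton numbers of deformations of `Γ`. There is at most one such list. -/
def IsNewtonSequence (Γ : Set (ℝ × ℝ)) (l : List ℤ) : Prop :=
  l.Pairwise (· > ·) ∧ ∀ k : ℤ, k ∈ l ↔ k ∈ attainedNumbers Γ

/-- The consecutive differences `ν₀ - ν₁, ν₁ - ν₂, …, νₛ₋₁ - νₛ`. -/
def jumps (l : List ℤ) : List ℤ := List.zipWith (· - ·) l l.tail

end NewtonJumps

namespace NewtonJumps
open MeasureTheory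

/-! A chain of edges from `(0, b₀)` to `(a₀, 0)`, sorted by steepness and without edges on the axes,
bounds a deformation with the same intercepts. Its Newton number is that of the triangle minus the
drop, the sum of the determinants of all pairs of edges (`newtonNumber_chainDiagram`). So every `k ≤
r(a₀ - r)` has to occur as a drop.

Write `b₀ = a₀ m + r`. The matrix `!![1, 1; m, m + 1]` has determinant one, hence preserves order
and drop; it sends `(a₀ - r, r)` to `(a₀, b₀)` and, as `m ≥ 1`, makes edges parallel to the axes
strictly decreasing (`exists_strict_chain`). It remains to realise all drops from `0` to `rs` by
chains with coprime displacement `(r, s)`, axis-parallel edges allowed; this is a Euclidean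
induction (`attainsDrop_of_coprime`).

No deformation exceeds the triangle: with intercepts `p ≤ a₀`, `q ≤ b₀`, convexity gives `2A ≤ pq`,
so its Newton number is at most `(p - 1)(q - 1) ≤ (a₀ - 1)(b₀ - 1)`. -/

/-- The edge vector `v` is at least as steep as `w`; the pair `(x, y)` stands for the edge that goes
`x` to the right and `y` down. -/
def Steeper (v w : ℕ × ℕ) : Prop := v.1 * w.2 ≤ w.1 * v.2

/-- The sum of the determinants of all pairs of vectors of a list. For a list sorted by
steepness this is twice the area between the polygonal chain and the chord of its endpoints. -/
def chainDrop : List (ℕ × ℕ) → ℤ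
  | [] => 0
  | w :: L => (w.2 : ℤ) * L.sum.1 - (w.1 : ℤ) * L.sum.2 + chainDrop L

/-- There is a convex chain with total displacement `(r, s)` that has drop `k`. -/
def AttainsDrop (r s k : ℕ) : Prop :=
  ∃ L : List (ℕ × ℕ), L.Pairwise Steeper ∧ L.sum = (r, s) ∧ chainDrop L = k

/-! ### Drops of convex lattice chains -/

theorem chainDrop_append (L M : List (ℕ × ℕ)) :
    chainDrop (L ++ M) =
      chainDrop L + chainDrop M + ((L.sum.2 : ℤ) * M.sum.1 - (L.sum.1 : ℤ) * M.sum.2) := by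
  induction L with
  | nil => simp [chainDrop]
  | cons w L ih =>
    simp only [List.cons_append, chainDrop, ih, List.sum_append, List.sum_cons, Prod.fst_add,
      Prod.snd_add]
    push_cast
    ring

theorem sum_map_swap (L : List (ℕ × ℕ)) : (L.map Prod.swap).sum = L.sum.swap := by
  induction L with
  | nil => rfl
  | cons w L ih => simp [ih]

/-- Swapping coordinates negates each determinant, and reversing the order negates it again. -/
theorem chainDrop_reverse_swap (L : List (ℕ × ℕ)) :
    chainDrop (L.map Prod.swap).reverse = chainDrop L := by
  induction L with
  | nil => rfl
  | cons w L ih =>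
    simp [chainDrop_append, chainDrop, ih, sum_map_swap]
    ring

theorem AttainsDrop.swap {r s k : ℕ} (h : AttainsDrop r s k) : AttainsDrop s r k := by
  obtain ⟨L, hL, hs, hd⟩ := h
  refine ⟨(L.map Prod.swap).reverse, ?_, ?_, ?_⟩
  · rw [List.pairwise_reverse, List.pairwise_map]
    refine hL.imp ?_
    intro v w h
    simp only [Steeper, Prod.fst_swap, Prod.snd_swap] at h ⊢
    linarith [mul_comm w.2 v.1, mul_comm v.2 w.1]
  · rw [List.sum_reverse, sum_map_swap, hs]
    rfl
  · rw [chainDrop_reverse_swap, hd]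

/-- The linear map of the lattice with matrix `!![p, q; s, t]`. -/
def latticeMap (p q s t : ℕ) (z : ℕ × ℕ) : ℕ × ℕ := (p * z.1 + q * z.2, s * z.1 + t * z.2)

theorem sum_map_latticeMap (p q s t : ℕ) (L : List (ℕ × ℕ)) :
    (L.map (latticeMap p q s t)).sum = latticeMap p q s t L.sum := by
  induction L with
  | nil => rfl
  | cons w L ih =>
    simp only [List.map_cons, List.sum_cons, ih, latticeMap, Prod.fst_add, Prod.snd_add,
      Prod.mk_add_mk]
    ext <;> simp <;> ring

theorem chainDrop_map_latticeMap {p q s t : ℕ} (h : p * t = q * s + 1) (L : List (ℕ × ℕ)) :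
    chainDrop (L.map (latticeMap p q s t)) = chainDrop L := by
  have h' : (p : ℤ) * t = q * s + 1 := by exact_mod_cast h
  induction L with
  | nil => rfl
  | cons w L ih =>
    simp only [List.map_cons, chainDrop, ih, sum_map_latticeMap]
    simp only [latticeMap]
    push_cast
    linear_combination ((w.2 : ℤ) * L.sum.1 - (w.1 : ℤ) * L.sum.2) * h'

theorem Steeper.latticeMap {p q s t : ℕ} (h : p * t = q * s + 1) {v w : ℕ × ℕ}
    (hvw : Steeper v w) : Steeper (latticeMap p q s t v) (latticeMap p q s t w) := by
  have h' : (p : ℤ) * t = q * s + 1 := by exact_mod_cast h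
  simp only [Steeper, NewtonJumps.latticeMap] at hvw ⊢
  zify at hvw ⊢
  have : ((p : ℤ) * w.1 + q * w.2) * (s * v.1 + t * v.2)
      - (p * v.1 + q * v.2) * (s * w.1 + t * w.2) = w.1 * v.2 - v.1 * w.2 := by
    linear_combination ((w.1 : ℤ) * v.2 - (v.1 : ℤ) * w.2) * h'
  linarith

theorem AttainsDrop.shear {r s k : ℕ} (h : AttainsDrop r s k) : AttainsDrop r (r + s) k := by
  obtain ⟨L, hL, hs, hd⟩ := h
  have hdet : 1 * 1 = 0 * 1 + 1 := rfl
  refine ⟨L.map (latticeMap 1 0 1 1), ?_, ?_, ?_⟩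
  · rw [List.pairwise_map]
    exact hL.imp fun h => h.latticeMap hdet
  · rw [sum_map_latticeMap, hs]
    simp [latticeMap]
  · rw [chainDrop_map_latticeMap hdet, hd]

/-- A vertical edge may precede any chain, and its determinants with the other edges add up to `r *
j`. -/
theorem AttainsDrop.add_vertical {r s k : ℕ} (h : AttainsDrop r s k) (j : ℕ) :
    AttainsDrop r (s + j) (k + r * j) := by
  obtain ⟨L, hL, hs, hd⟩ := h
  refine ⟨(0, j) :: L, ?_, ?_, ?_⟩
  · rw [List.pairwise_cons]
    exact ⟨fun w _ => by simp [Steeper], hL⟩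
  · simp [hs, add_comm]
  · simp [chainDrop, hs, hd]
    ring

theorem AttainsDrop.add_horizontal {r s k : ℕ} (h : AttainsDrop r s k) (j : ℕ) :
    AttainsDrop (r + j) s (k + s * j) :=
  (h.swap.add_vertical j).swap

theorem attainsDrop_zero (r s : ℕ) : AttainsDrop r s 0 :=
  ⟨[(r, s)], by simp, by simp, by simp [chainDrop]⟩

theorem attainsDrop_succ_of_le {r k : ℕ} (h₁ : r ≤ k) (h₂ : k ≤ 2 * r) :
    AttainsDrop r (r + 1) k := by
  obtain ⟨i, rfl⟩ := Nat.exists_eq_add_of_le h₁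
  obtain ⟨j, rfl⟩ := Nat.exists_eq_add_of_le (show i ≤ r by omega)
  rcases i with _ | i
  · exact ⟨[(0, 1), (j, j)], by simp [Steeper], by simp [add_comm], by simp [chainDrop]⟩
  -- Here `r = i + 1 + j`; the determinant is `(j + 2)(i + 1) - j i = r + (i + 1)`.
  · refine ⟨[(j, j + 2), (i + 1, i)], ?_, ?_, ?_⟩
    · simp only [List.pairwise_cons, List.mem_singleton, forall_eq, List.not_mem_nil,
        Steeper, List.Pairwise.nil]
      refine ⟨?_, by simp⟩
      nlinarith
    · simp
      constructor <;> ring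
    · simp [chainDrop]
      ring

/-- For `s = r + d`, shearing chains for `(r, d)` gives the drops up to `rd`. Larger drops come from
attaching axis-parallel edges to a chain for a smaller pair of consecutive integers, which is
automatically coprime; `(r, r + 1)` needs explicit two-edge chains for the drops from `r` to `2r`.
-/
theorem attainsDrop_of_coprime (r s k : ℕ) (hcop : Nat.Coprime r s) (hk : k ≤ r * s) :
    AttainsDrop r s k := by
  induction hn : r + s using Nat.strong_induction_on generalizing r s k with
  | _ n ih =>
  subst hn
  wlog hrs : r ≤ s generalizing r s
  · exact (this s r hcop.symm (by rwa [mul_comm]) (fun m hm r' s' k' => ih m (by omega) r' s' k')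
      (by omega)).swap
  rcases Nat.eq_zero_or_pos r with rfl | hr
  · obtain rfl : k = 0 := by simpa using hk
    exact attainsDrop_zero _ _
  obtain ⟨d, rfl⟩ := Nat.exists_eq_add_of_le hrs
  by_cases hkd : k ≤ r * d
  · exact (ih (r + d) (by omega) r d k (by simpa using hcop) hkd rfl).shear
  push Not at hkd
  rcases d with _ | _ | d
  · obtain rfl : r = 1 := by simpa using hcop
    obtain rfl : k = 1 := by omega
    exact (attainsDrop_zero 1 0).add_vertical 1
  · rcases le_or_gt k (2 * r) with h | h
    · exact attainsDrop_succ_of_le (by omega) h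
    · obtain ⟨q, rfl⟩ := Nat.exists_eq_add_of_lt hr
      obtain ⟨l, rfl⟩ := Nat.exists_eq_add_of_lt h
      -- With `r = q + 1`, a vertical unit edge adds `q` and then a horizontal one adds `q + 2`,
      -- together `2r`.
      have := ((ih (q + (q + 1)) (by omega) q (q + 1) (l + 1) (by simp) (by nlinarith)
        rfl).add_vertical 1).add_horizontal 1
      convert this using 1 <;> ring
  · obtain ⟨l, rfl⟩ := Nat.exists_eq_add_of_lt hkd
    have := (ih (r + (r + 1)) (by omega) r (r + 1) (l + 1 + r) (by simp) (by nlinarith)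
      rfl).add_vertical (d + 1)
    convert this using 1 <;> ring

/-- The chain is strictly decreasing: apart from zero vectors it has no edge parallel to an axis. -/
theorem exists_strict_chain {a r m k : ℕ} (hm : 1 ≤ m) (hra : r ≤ a) (hcop : Nat.Coprime a r)
    (hk : k ≤ r * (a - r)) :
    ∃ L : List (ℕ × ℕ), L.Pairwise Steeper ∧ L.sum = (a, a * m + r) ∧ chainDrop L = k ∧
      ∀ w ∈ L, w.1 = 0 ↔ w.2 = 0 := by
  obtain ⟨s, rfl⟩ := Nat.exists_eq_add_of_le hra
  obtain ⟨L, hL, hs, hd⟩ := attainsDrop_of_coprime s r k (by simpa using hcop)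
    (by simpa [mul_comm] using hk)
  have hdet : 1 * (m + 1) = 1 * m + 1 := by ring
  refine ⟨L.map (latticeMap 1 1 m (m + 1)), ?_, ?_, ?_, ?_⟩
  · rw [List.pairwise_map]
    exact hL.imp fun h => h.latticeMap hdet
  · rw [sum_map_latticeMap, hs]
    simp only [latticeMap]
    ext <;> simp <;> ring
  · rw [chainDrop_map_latticeMap hdet, hd]
  · intro w hw
    obtain ⟨z, -, rfl⟩ := List.mem_map.1 hw
    simp [latticeMap, show m ≠ 0 by omega]

/-! ### Initial jumps of a decreasing list -/

/-- A strictly decreasing list with maximum `N` that contains `N, N - 1, …, N - n` begins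
with these numbers. -/
theorem replicate_one_prefix_jumps (n : ℕ) (N : ℤ) (l : List ℤ) (hl : l.Pairwise (· > ·))
    (hN : ∀ k ∈ l, k ≤ N) (hmem : ∀ i : ℕ, i ≤ n → N - i ∈ l) :
    l.head? = some N ∧ List.replicate n (1 : ℤ) <+: jumps l := by
  induction n generalizing N l with
  | zero =>
    have h0 := hmem 0 le_rfl
    rcases l with _ | ⟨x, t⟩
    · simp at h0
    rw [List.pairwise_cons] at hl
    have hx := hN x (by simp)
    simp only [Nat.cast_zero, sub_zero, List.mem_cons] at h0
    rcases h0 with rfl | h0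
    · simp
    · exact absurd (hl.1 _ h0) (by simpa using hx)
  | succ n ih =>
    have h0 := hmem 0 (by omega)
    rcases l with _ | ⟨x, t⟩
    · simp at h0
    rw [List.pairwise_cons] at hl
    have hx := hN x (by simp)
    simp only [Nat.cast_zero, sub_zero, List.mem_cons] at h0
    obtain rfl : N = x := h0.resolve_right fun h => absurd (hl.1 _ h) (by simpa using hx)
    obtain ⟨h1, h2⟩ := ih (N - 1) t hl.2 (fun k hk => by have := hl.1 k hk; omega) (by
      intro i hi
      have := hmem (i + 1) (by omega)
      rw [List.mem_cons] at this
      push_cast at this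
      rcases this with h | h
      · omega
      · rwa [sub_sub, add_comm (1 : ℤ)])
    refine ⟨rfl, ?_⟩
    rcases t with _ | ⟨y, t⟩
    · simp at h1
    obtain rfl : y = N - 1 := by simpa using h1
    simpa [jumps, List.replicate_succ] using h2

/-! ### Newton diagrams as convex upper sets -/

theorem mem_newtonDiagram_of_le {S : Set (ℝ × ℝ)} {P z : ℝ × ℝ} (hP : P ∈ S) (h : P ≤ z) :
    z ∈ newtonDiagram S := by
  refine subset_convexHull ℝ _ (Set.mem_biUnion hP ⟨z - P, ?_, by simp⟩)
  exact ⟨sub_nonneg.2 h.1, sub_nonneg.2 h.2⟩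

theorem subset_newtonDiagram (S : Set (ℝ × ℝ)) : S ⊆ newtonDiagram S :=
  fun _ hP => mem_newtonDiagram_of_le hP le_rfl

theorem convex_newtonDiagram (S : Set (ℝ × ℝ)) : Convex ℝ (newtonDiagram S) :=
  convex_convexHull ℝ _

theorem newtonDiagram_subset {S C : Set (ℝ × ℝ)} (hC : Convex ℝ C) (hup : IsUpperSet C)
    (h : S ⊆ C) : newtonDiagram S ⊆ C := by
  refine convexHull_min ?_ hC
  refine Set.iUnion₂_subset fun P hP => ?_
  rintro _ ⟨z, hz, rfl⟩
  exact hup (show P ≤ P + z from ⟨le_add_of_nonneg_right hz.1, le_add_of_nonneg_right hz.2⟩) (h hP)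

theorem isUpperSet_newtonDiagram (S : Set (ℝ × ℝ)) : IsUpperSet (newtonDiagram S) := by
  intro z z' hzz hz
  have hsub : newtonDiagram S ⊆ (fun y => y + (z' - z)) ⁻¹' newtonDiagram S := by
    refine convexHull_min (Set.iUnion₂_subset fun P hP => ?_)
      ((convex_newtonDiagram S).translate_preimage_left _)
    rintro _ ⟨y, hy, rfl⟩
    refine mem_newtonDiagram_of_le hP ?_
    have h1 : 0 ≤ z' - z := sub_nonneg.2 hzz
    have h2 : (0 : ℝ × ℝ) ≤ y := hy
    change P ≤ P + y + (z' - z)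
    rw [add_assoc]
    exact le_add_of_nonneg_right (add_nonneg h2 h1)
  simpa using hsub hz

theorem newtonDiagram_mono {S T : Set (ℝ × ℝ)} (h : S ⊆ T) : newtonDiagram S ⊆ newtonDiagram T :=
  newtonDiagram_subset (convex_newtonDiagram T) (isUpperSet_newtonDiagram T)
    (h.trans (subset_newtonDiagram T))

theorem newtonDiagram_newtonDiagram_union (S T : Set (ℝ × ℝ)) :
    newtonDiagram (newtonDiagram S ∪ T) = newtonDiagram (S ∪ T) := by
  refine Set.Subset.antisymm ?_ (newtonDiagram_mono
    (Set.union_subset_union_left T (subset_newtonDiagram S)))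
  refine newtonDiagram_subset (convex_newtonDiagram _) (isUpperSet_newtonDiagram _)
    (Set.union_subset (newtonDiagram_mono Set.subset_union_left)
      (Set.subset_union_right.trans (subset_newtonDiagram _)))

theorem newtonDiagram_translate_subset {S T : Set (ℝ × ℝ)} (d : ℝ × ℝ)
    (h : ∀ z ∈ S, d + z ∈ T) {z : ℝ × ℝ} (hz : z ∈ newtonDiagram S) :
    d + z ∈ newtonDiagram T := by
  have : newtonDiagram S ⊆ (fun y => d + y) ⁻¹' newtonDiagram T := by
    refine newtonDiagram_subset ((convex_newtonDiagram T).translate_preimage_right _) ?_ ?_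
    · intro x y hxy hx
      exact isUpperSet_newtonDiagram T (add_le_add_right hxy d) hx
    · exact fun z hz => subset_newtonDiagram T (h z hz)
  exact this hz

/-! ### Area under a segment -/

/-- The half-open trapezoid below the segment from `(0, h)` to `(u, h - v)`. -/
def trapezoid (u v h : ℝ) : Set (ℝ × ℝ) :=
  {z | 0 ≤ z.1 ∧ z.1 < u ∧ 0 ≤ z.2 ∧ v * z.1 + u * z.2 < u * h}

theorem measurableSet_trapezoid (u v h : ℝ) : MeasurableSet (trapezoid u v h) := by
  unfold trapezoid
  have h1 : Measurable fun z : ℝ × ℝ => v * z.1 + u * z.2 := by fun_prop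
  exact (measurableSet_le measurable_const measurable_fst).inter
    ((measurableSet_lt measurable_fst measurable_const).inter
      ((measurableSet_le measurable_const measurable_snd).inter
        (measurableSet_lt h1 measurable_const)))

theorem volume_trapezoid {u v h : ℝ} (hu : 0 ≤ u) (hv : 0 ≤ v) (hvh : v ≤ h) :
    volume (trapezoid u v h) = ENNReal.ofReal (u * (2 * h - v) / 2) := by
  rcases hu.eq_or_lt with rfl | hu
  · have : trapezoid 0 v h = ∅ := by
      ext z
      simp only [trapezoid, Set.mem_ofPred_eq, Set.mem_empty_iff_false, iff_false]
      rintro ⟨h1, h2, -⟩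
      linarith
    simp [this]
  rw [Measure.volume_eq_prod, Measure.prod_apply (measurableSet_trapezoid u v h)]
  have hsec : ∀ x : ℝ, volume (Prod.mk x ⁻¹' trapezoid u v h)
      = (Set.Ico 0 u).indicator (fun x => ENNReal.ofReal (h - v / u * x)) x := by
    intro x
    by_cases hx : x ∈ Set.Ico 0 u
    · rw [Set.indicator_of_mem hx]
      have : Prod.mk x ⁻¹' trapezoid u v h = Set.Ico 0 (h - v / u * x) := by
        ext y
        simp only [trapezoid, Set.mem_preimage, Set.mem_ofPred_eq, Set.mem_Ico]
        have h1 : v * x + u * y < u * h ↔ y < h - v / u * x := by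
          rw [← mul_lt_mul_iff_right₀ hu (b := y)]
          have : u * (h - v / u * x) = u * h - v * x := by field_simp
          rw [this]
          constructor <;> intro <;> linarith
        rw [h1]
        exact ⟨fun h => h.2.2, fun h => ⟨hx.1, hx.2, h⟩⟩
      rw [this, Real.volume_Ico, sub_zero]
    · rw [Set.indicator_of_notMem hx]
      have : Prod.mk x ⁻¹' trapezoid u v h = ∅ := by
        ext y
        simp only [trapezoid, Set.mem_preimage, Set.mem_ofPred_eq, Set.mem_empty_iff_false, iff_false]
        exact fun h => hx ⟨h.1, h.2.1⟩
      simp [this]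
  simp_rw [hsec]
  rw [lintegral_indicator measurableSet_Ico, restrict_Ico_eq_restrict_Ioc,
    ← ofReal_integral_eq_lintegral_ofReal, ← intervalIntegral.integral_of_le hu.le]
  · congr 1
    rw [intervalIntegral.integral_sub intervalIntegrable_const
        ((by fun_prop : Continuous fun x : ℝ => v / u * x).intervalIntegrable _ _),
      intervalIntegral.integral_const_mul, integral_id]
    simp
    field_simp
  · exact ((by fun_prop : Continuous fun x : ℝ => h - v / u * x).integrableOn_Icc
      (a := 0) (b := u)).mono_set Set.Ioc_subset_Icc_self
  · filter_upwards [ae_restrict_mem measurableSet_Ioc] with x hx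
    have : v / u * x ≤ v := by
      rw [div_mul_eq_mul_div, div_le_iff₀ hu]
      exact mul_le_mul_of_nonneg_left hx.2 hv
    simp only [Pi.zero_apply]
    linarith

/-! ### Chain diagrams as intersections of half-planes -/

/-- The vertices of the chain from `(0, Y)` to `(X, 0)` with the given successive edges. -/
def chainVertices : List (ℕ × ℕ) → List (ℕ × ℕ)
  | [] => [(0, 0)]
  | w :: L => (0, w.2 + L.sum.2) :: (chainVertices L).map fun z => (w.1 + z.1, z.2)

/-- The diagram supported by the vertices of a chain. -/
def chainDiagram (L : List (ℕ × ℕ)) : Set (ℝ × ℝ) :=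
  newtonDiagram (latticePoint '' {z | z ∈ chainVertices L})

/-- The intersection of the half-planes above the lines spanned by the edges of a chain. -/
def chainHalfPlanes : List (ℕ × ℕ) → Set (ℝ × ℝ)
  | [] => {z | 0 ≤ z.2}
  | w :: L => {z | (w.1 : ℝ) * (w.2 + L.sum.2) ≤ w.2 * z.1 + w.1 * z.2} ∩
      (fun z => z + (-(w.1 : ℝ), 0)) ⁻¹' chainHalfPlanes L

theorem convex_setOf_le_linear (a b c : ℝ) : Convex ℝ {z : ℝ × ℝ | c ≤ a * z.1 + b * z.2} := by
  intro x hx y hy s t hs ht hst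
  simp only [Set.mem_ofPred_eq, Prod.fst_add, Prod.smul_fst, Prod.snd_add, Prod.smul_snd,
    smul_eq_mul] at *
  calc c = s * c + t * c := by rw [← add_mul, hst, one_mul]
    _ ≤ s * (a * x.1 + b * x.2) + t * (a * y.1 + b * y.2) := by gcongr
    _ = _ := by ring

theorem isUpperSet_setOf_le_linear {a b : ℝ} (ha : 0 ≤ a) (hb : 0 ≤ b) (c : ℝ) :
    IsUpperSet {z : ℝ × ℝ | c ≤ a * z.1 + b * z.2} := by
  intro x y hxy hx
  exact le_trans hx (add_le_add (mul_le_mul_of_nonneg_left hxy.1 ha)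
    (mul_le_mul_of_nonneg_left hxy.2 hb))

theorem convex_chainHalfPlanes (L : List (ℕ × ℕ)) : Convex ℝ (chainHalfPlanes L) := by
  induction L with
  | nil => simpa [chainHalfPlanes] using convex_setOf_le_linear 0 1 0
  | cons w L ih => exact (convex_setOf_le_linear _ _ _).inter (ih.translate_preimage_left _)

theorem isUpperSet_chainHalfPlanes (L : List (ℕ × ℕ)) : IsUpperSet (chainHalfPlanes L) := by
  induction L with
  | nil => exact fun x y hxy hx => le_trans hx hxy.2
  | cons w L ih =>
    refine (isUpperSet_setOf_le_linear (by positivity) (by positivity) _).inter ?_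
    exact fun x y hxy hx => ih (add_le_add_left hxy _) hx

/-- The start of an edge `w` placed before the chain lies above every later edge line. The induction
merges `w` with the first edge `z`: the sum `w + z` is still at least as steep as the remaining
edges. -/
theorem mem_chainHalfPlanes_of_steeper {L : List (ℕ × ℕ)} (hL : L.Pairwise Steeper) (w : ℕ × ℕ)
    (h : ∀ z ∈ L, Steeper w z) :
    (-(w.1 : ℝ), (w.2 : ℝ) + L.sum.2) ∈ chainHalfPlanes L := by
  induction L generalizing w with
  | nil => simp [chainHalfPlanes]
  | cons z L ih =>
    rw [List.pairwise_cons] at hL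
    have hz : (w.1 : ℝ) * z.2 ≤ z.1 * w.2 := by exact_mod_cast h z (by simp)
    refine ⟨?_, ?_⟩
    · simp only [Set.mem_ofPred_eq, List.sum_cons, Prod.snd_add, Nat.cast_add]
      linarith
    · have := ih hL.2 (w + z) (fun x hx => ?_)
      · simp only [Set.mem_preimage, List.sum_cons, Prod.snd_add, Prod.fst_add, Nat.cast_add,
          Prod.mk_add_mk] at this ⊢
        convert this using 2 <;> ring
      · have h1 := hL.1 x hx
        have h2 := h x (by simp [hx])
        simp only [Steeper, Prod.fst_add, Prod.snd_add] at *
        linarith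

theorem le_of_mem_chainVertices {L : List (ℕ × ℕ)} {w : ℕ × ℕ} (h : ∀ z ∈ L, Steeper w z)
    {z : ℕ × ℕ} (hz : z ∈ chainVertices L) : w.1 * L.sum.2 ≤ w.2 * z.1 + w.1 * z.2 := by
  induction L generalizing z with
  | nil => simp
  | cons x L ih =>
    simp only [chainVertices, List.mem_cons, List.mem_map] at hz
    rcases hz with rfl | ⟨y, hy, rfl⟩
    · simp
    · have h1 := ih (fun z hz => h z (by simp [hz])) hy
      have h2 := h x (by simp)
      simp only [Steeper, List.sum_cons, Prod.snd_add] at *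
      linarith [mul_comm x.1 w.2, mul_add w.2 x.1 y.1, mul_add w.1 x.2 L.sum.2]

theorem latticePoint_mem_chainHalfPlanes {L : List (ℕ × ℕ)} (hL : L.Pairwise Steeper)
    {z : ℕ × ℕ} (hz : z ∈ chainVertices L) : latticePoint z ∈ chainHalfPlanes L := by
  induction L generalizing z with
  | nil => simp [chainHalfPlanes, latticePoint]
  | cons w L ih =>
    rw [List.pairwise_cons] at hL
    simp only [chainVertices, List.mem_cons, List.mem_map] at hz
    rcases hz with rfl | ⟨y, hy, rfl⟩
    · refine ⟨by simp [latticePoint], ?_⟩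
      simpa [latticePoint] using mem_chainHalfPlanes_of_steeper hL.2 w hL.1
    · refine ⟨?_, ?_⟩
      · have : (w.1 : ℝ) * L.sum.2 ≤ w.2 * y.1 + w.1 * y.2 := by
          exact_mod_cast le_of_mem_chainVertices hL.1 hy
        simp only [latticePoint, Set.mem_ofPred_eq, Nat.cast_add]
        linarith
      · simpa [latticePoint] using ih hL.2 hy

theorem first_mem_chainVertices (L : List (ℕ × ℕ)) : (0, L.sum.2) ∈ chainVertices L := by
  cases L <;> simp [chainVertices]

theorem last_mem_chainVertices (L : List (ℕ × ℕ)) : (L.sum.1, 0) ∈ chainVertices L := by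
  induction L with
  | nil => simp [chainVertices]
  | cons w L ih => exact List.mem_cons_of_mem _ (List.mem_map.2 ⟨_, ih, by simp⟩)

theorem latticePoint_mem_chainDiagram {L : List (ℕ × ℕ)} {z : ℕ × ℕ} (hz : z ∈ chainVertices L) :
    latticePoint z ∈ chainDiagram L :=
  subset_newtonDiagram _ ⟨z, hz, rfl⟩

theorem convex_quadrant : Convex ℝ quadrant := by
  have h := (convex_setOf_le_linear 1 0 0).inter (convex_setOf_le_linear 0 1 0)
  convert h using 1
  ext z
  simp [quadrant]

theorem isUpperSet_quadrant : IsUpperSet quadrant :=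
  fun _ _ hxy hx => ⟨hx.1.trans hxy.1, hx.2.trans hxy.2⟩

theorem latticePoint_mem_quadrant (z : ℕ × ℕ) : latticePoint z ∈ quadrant :=
  ⟨Nat.cast_nonneg _, Nat.cast_nonneg _⟩

theorem chainDiagram_subset_quadrant (L : List (ℕ × ℕ)) : chainDiagram L ⊆ quadrant := by
  refine newtonDiagram_subset convex_quadrant isUpperSet_quadrant ?_
  rintro _ ⟨z, -, rfl⟩
  exact latticePoint_mem_quadrant z

theorem chainDiagram_subset_chainHalfPlanes {L : List (ℕ × ℕ)} (hL : L.Pairwise Steeper) :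
    chainDiagram L ⊆ chainHalfPlanes L := by
  refine newtonDiagram_subset (convex_chainHalfPlanes L) (isUpperSet_chainHalfPlanes L) ?_
  rintro _ ⟨z, hz, rfl⟩
  exact latticePoint_mem_chainHalfPlanes hL hz

theorem chainDiagram_nil : chainDiagram [] = quadrant := by
  refine (chainDiagram_subset_quadrant _).antisymm fun z hz => ?_
  refine mem_newtonDiagram_of_le ⟨(0, 0), by simp [chainVertices], rfl⟩ ?_
  exact ⟨by simpa [latticePoint] using hz.1, by simpa [latticePoint] using hz.2⟩

/-- Such a point lies vertically above a convex combination of the endpoints of the first edge. -/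
theorem mem_chainDiagram_cons_of_lt {w : ℕ × ℕ} {L : List (ℕ × ℕ)} {z : ℝ × ℝ} (h0 : 0 ≤ z.1)
    (h1 : z.1 < w.1) (h : (w.1 : ℝ) * (w.2 + L.sum.2) ≤ w.2 * z.1 + w.1 * z.2) :
    z ∈ chainDiagram (w :: L) := by
  have hu : (0 : ℝ) < w.1 := h0.trans_lt h1
  have hP : latticePoint (0, w.2 + L.sum.2) ∈ chainDiagram (w :: L) :=
    latticePoint_mem_chainDiagram (by simp [chainVertices])
  have hQ : latticePoint (w.1, L.sum.2) ∈ chainDiagram (w :: L) :=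
    latticePoint_mem_chainDiagram (List.mem_cons_of_mem _
      (List.mem_map.2 ⟨_, first_mem_chainVertices L, by simp⟩))
  have ht : z.1 / w.1 ≤ 1 := (div_le_one hu).2 h1.le
  refine isUpperSet_newtonDiagram _ ?_ (convex_newtonDiagram _ hP hQ (sub_nonneg.2 ht)
    (div_nonneg h0 hu.le) (by ring))
  refine ⟨?_, ?_⟩
  · simp [latticePoint]
    field_simp
    rfl
  · simp only [latticePoint, Prod.snd_add, Prod.smul_snd, smul_eq_mul]
    rw [← mul_le_mul_iff_right₀ hu]
    have : (w.1 : ℝ) * ((1 - z.1 / w.1) * ((w.2 + L.sum.2 : ℕ) : ℝ) + z.1 / w.1 * (L.sum.2 : ℝ))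
        = w.1 * (w.2 + L.sum.2) - w.2 * z.1 := by
      push_cast
      field_simp
      ring
    rw [this]
    linarith

theorem mem_chainDiagram_cons_of_translate {w : ℕ × ℕ} {L : List (ℕ × ℕ)} {z : ℝ × ℝ}
    (h : z + (-(w.1 : ℝ), 0) ∈ chainDiagram L) : z ∈ chainDiagram (w :: L) := by
  have := newtonDiagram_translate_subset (T := latticePoint '' {z | z ∈ chainVertices (w :: L)})
    ((w.1 : ℝ), 0) ?_ h
  · rwa [show ((w.1 : ℝ), (0 : ℝ)) + (z + (-(w.1 : ℝ), 0)) = z by ext <;> simp] at this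
  · rintro _ ⟨y, hy, rfl⟩
    refine ⟨(w.1 + y.1, y.2), ?_, by simp [latticePoint]⟩
    simp only [Set.mem_ofPred_eq, chainVertices, List.mem_cons, List.mem_map]
    exact Or.inr ⟨y, hy, rfl⟩

theorem mem_chainDiagram_iff {L : List (ℕ × ℕ)} (hL : L.Pairwise Steeper) (z : ℝ × ℝ) :
    z ∈ chainDiagram L ↔ z ∈ quadrant ∧ z ∈ chainHalfPlanes L := by
  refine ⟨fun h => ⟨chainDiagram_subset_quadrant L h, chainDiagram_subset_chainHalfPlanes hL h⟩, ?_⟩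
  rintro ⟨hq, hz⟩
  induction L generalizing z with
  | nil => rwa [chainDiagram_nil]
  | cons w L ih =>
    rw [List.pairwise_cons] at hL
    rcases lt_or_ge z.1 w.1 with h | h
    · exact mem_chainDiagram_cons_of_lt hq.1 h hz.1
    · refine mem_chainDiagram_cons_of_translate (ih hL.2 _ ⟨?_, ?_⟩ hz.2)
      · simpa using h
      · simpa using hq.2

/-! ### Area and Newton number of a chain diagram -/

theorem quadrant_diff_chainDiagram_cons {w : ℕ × ℕ} {L : List (ℕ × ℕ)}
    (hL : (w :: L).Pairwise Steeper) :
    quadrant \ chainDiagram (w :: L) = trapezoid w.1 w.2 (w.2 + L.sum.2) ∪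
      (fun z => z + (-(w.1 : ℝ), 0)) ⁻¹' (quadrant \ chainDiagram L) := by
  ext z
  constructor
  · rintro ⟨hq, hz⟩
    rcases lt_or_ge z.1 w.1 with h | h
    · refine Or.inl ⟨hq.1, h, hq.2, ?_⟩
      by_contra! hc
      exact hz (mem_chainDiagram_cons_of_lt hq.1 h hc)
    · refine Or.inr ⟨⟨by simpa using h, by simpa using hq.2⟩, fun hc => hz ?_⟩
      exact mem_chainDiagram_cons_of_translate hc
  · rintro (⟨h1, h2, h3, h4⟩ | ⟨⟨h1, h2⟩, h3⟩)
    · refine ⟨⟨h1, h3⟩, fun hc => ?_⟩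
      exact absurd ((mem_chainDiagram_iff hL z).1 hc).2.1 (not_le.2 h4)
    · have h1' : (w.1 : ℝ) ≤ z.1 := by simpa using h1
      refine ⟨⟨le_trans (by positivity) h1', by simpa using h2⟩, fun hc => h3 ?_⟩
      exact (mem_chainDiagram_iff (List.pairwise_cons.1 hL).2 _).2
        ⟨⟨h1, h2⟩, ((mem_chainDiagram_iff hL z).1 hc).2.2⟩

/-- One trapezoid is cut off per edge. Nonnegativity is carried along because `ENNReal.ofReal` is
additive only on nonnegative terms. -/
theorem volume_quadrant_diff_chainDiagram {L : List (ℕ × ℕ)} (hL : L.Pairwise Steeper) :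
    0 ≤ (L.sum.1 : ℝ) * L.sum.2 - chainDrop L ∧ volume (quadrant \ chainDiagram L) =
      ENNReal.ofReal (((L.sum.1 : ℝ) * L.sum.2 - chainDrop L) / 2) := by
  induction L with
  | nil => simp [chainDiagram_nil, chainDrop]
  | cons w L ih =>
    obtain ⟨h0, hv⟩ := ih (List.pairwise_cons.1 hL).2
    have hrec : (((w :: L).sum.1 : ℝ) * (w :: L).sum.2 - chainDrop (w :: L)) / 2 =
        (w.1 * (2 * (w.2 + L.sum.2) - w.2) / 2 : ℝ) +
          ((L.sum.1 : ℝ) * L.sum.2 - chainDrop L) / 2 := by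
      simp [chainDrop]
      ring
    have hnn : (0 : ℝ) ≤ w.1 * (2 * (w.2 + L.sum.2) - w.2) / 2 := by
      have : (0 : ℝ) ≤ 2 * (w.2 + L.sum.2) - w.2 := by
        have h1 : (0 : ℝ) ≤ w.2 := by positivity
        have h2 : (0 : ℝ) ≤ L.sum.2 := by positivity
        linarith
      positivity
    refine ⟨by linarith, ?_⟩
    rw [hrec, ENNReal.ofReal_add hnn (by linarith), ← hv, quadrant_diff_chainDiagram_cons hL,
      measure_union' _ (measurableSet_trapezoid _ _ _), measure_preimage_add_right,
      volume_trapezoid (by positivity) (by positivity) (by simp)]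
    rw [Set.disjoint_left]
    rintro z ⟨-, h, -⟩ ⟨⟨h', -⟩, -⟩
    exact absurd h (not_lt.2 (by simpa using h'))

/-- A vertical first edge would lie on the axis and lower the intercept; strictness rules this out,
while zero edges are harmless. -/
theorem le_snd_of_mem_chainHalfPlanes {L : List (ℕ × ℕ)} (hL : ∀ w ∈ L, w.1 = 0 ↔ w.2 = 0) {y : ℝ}
    (hy : 0 ≤ y) (h : ((0 : ℝ), y) ∈ chainHalfPlanes L) : (L.sum.2 : ℝ) ≤ y := by
  induction L with
  | nil => simpa using hy
  | cons w L ih =>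
    rcases Nat.eq_zero_or_pos w.1 with hw | hw
    · have hw2 := (hL w (by simp)).1 hw
      have := ih (fun w hw => hL w (by simp [hw])) (by simpa [hw] using h.2)
      simpa [hw2] using this
    · have hw' : (0 : ℝ) < w.1 := by exact_mod_cast hw
      have := h.1
      simp only [Set.mem_ofPred_eq, mul_zero, zero_add] at this
      simpa using le_of_mul_le_mul_left this hw'

theorem le_fst_of_mem_chainHalfPlanes {L : List (ℕ × ℕ)} (hL : ∀ w ∈ L, w.1 = 0 ↔ w.2 = 0) {x : ℝ}
    (hx : 0 ≤ x) (h : (x, (0 : ℝ)) ∈ chainHalfPlanes L) : (L.sum.1 : ℝ) ≤ x := by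
  induction L generalizing x with
  | nil => simpa using hx
  | cons w L ih =>
    rcases lt_or_ge x w.1 with hxw | hxw
    · exfalso
      have hw : 0 < w.1 := by
        have := hx.trans_lt hxw
        exact_mod_cast this
      have hw2 : (0 : ℝ) < w.2 := by
        have := mt (hL w (by simp)).2 (by omega)
        exact_mod_cast Nat.pos_of_ne_zero this
      have h1 := h.1
      simp only [Set.mem_ofPred_eq, mul_zero, add_zero] at h1
      have h2 : (0 : ℝ) ≤ w.1 * L.sum.2 := by positivity
      nlinarith
    · have := ih (fun w hw => hL w (by simp [hw])) (sub_nonneg.2 hxw)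
        (by simpa [sub_eq_add_neg] using h.2)
      simp
      linarith

theorem newtonNumber_chainDiagram {L : List (ℕ × ℕ)} (hL : L.Pairwise Steeper)
    (hstrict : ∀ w ∈ L, w.1 = 0 ↔ w.2 = 0) :
    newtonNumber (chainDiagram L) =
      (L.sum.1 : ℝ) * L.sum.2 - chainDrop L - L.sum.1 - L.sum.2 + 1 := by
  obtain ⟨h0, hv⟩ := volume_quadrant_diff_chainDiagram hL
  have hp : sInf {x : ℝ | (x, (0 : ℝ)) ∈ chainDiagram L} = L.sum.1 := by
    refine IsLeast.csInf_eq ⟨?_, fun x hx => ?_⟩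
    · simpa [latticePoint] using latticePoint_mem_chainDiagram (last_mem_chainVertices L)
    · obtain ⟨hq, hx⟩ := (mem_chainDiagram_iff hL _).1 hx
      exact le_fst_of_mem_chainHalfPlanes hstrict hq.1 hx
  have hq : sInf {y : ℝ | ((0 : ℝ), y) ∈ chainDiagram L} = L.sum.2 := by
    refine IsLeast.csInf_eq ⟨?_, fun x hx => ?_⟩
    · simpa [latticePoint] using latticePoint_mem_chainDiagram (first_mem_chainVertices L)
    · obtain ⟨hq, hx⟩ := (mem_chainDiagram_iff hL _).1 hx
      exact le_snd_of_mem_chainHalfPlanes hstrict hq.2 hx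
  rw [newtonNumber, hv, hp, hq, ENNReal.toReal_ofReal (by linarith)]
  ring

theorem isDeformation_chainDiagram {L : List (ℕ × ℕ)} (hL : L.Pairwise Steeper)
    (hstrict : ∀ w ∈ L, w.1 = 0 ↔ w.2 = 0) (hpos : 0 < L.sum.1) :
    IsDeformation (triangle L.sum.1 L.sum.2) (chainDiagram L) := by
  refine ⟨(chainVertices L).toFinset, ?_, ?_⟩
  · rw [List.mem_toFinset]
    intro h
    have := latticePoint_mem_chainHalfPlanes hL h
    have := le_fst_of_mem_chainHalfPlanes hstrict le_rfl (by simpa [latticePoint] using this)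
    norm_cast at this
    omega
  · rw [addPoints, triangle, newtonDiagram_newtonDiagram_union, chainDiagram]
    congr 1
    rw [Set.union_eq_self_of_subset_left]
    · ext z
      simp
    · rintro z (rfl | rfl)
      · exact ⟨_, by simpa using last_mem_chainVertices L, rfl⟩
      · exact ⟨_, by simpa using first_mem_chainVertices L, rfl⟩

theorem chainDiagram_singleton (a b : ℕ) : chainDiagram [(a, b)] = triangle a b := by
  rw [chainDiagram, triangle]
  congr 1
  ext z
  simp only [chainVertices, Set.mem_image, Set.mem_ofPred_eq]
  constructor
  · rintro ⟨y, hy, rfl⟩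
    simp at hy
    rcases hy with rfl | rfl <;> simp
  · rintro (rfl | rfl)
    · exact ⟨_, by simp, rfl⟩
    · exact ⟨_, by simp, rfl⟩

theorem newtonNumber_triangle {a b : ℕ} (ha : 0 < a) (hb : 0 < b) :
    newtonNumber (triangle a b) = (a : ℝ) * b - a - b + 1 := by
  rw [← chainDiagram_singleton, newtonNumber_chainDiagram (by simp) (by simp; omega)]
  simp [chainDrop]

/-! ### Maximality of the Newton number of the triangle -/

theorem volume_quadrant_diff_le {S : Set (ℝ × ℝ)} {x y : ℝ} (hx : 0 < x) (hy : 0 < y)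
    (hxS : (x, (0 : ℝ)) ∈ newtonDiagram S) (hyS : ((0 : ℝ), y) ∈ newtonDiagram S) :
    (volume (quadrant \ newtonDiagram S)).toReal ≤ x * y / 2 := by
  have hsub : quadrant \ newtonDiagram S ⊆ trapezoid x y y := by
    rintro z ⟨⟨h1, h2⟩, hz⟩
    have hlt : y * z.1 + x * z.2 < x * y := by
      by_contra! hc
      apply hz
      rcases le_or_gt x z.1 with h | h
      · exact isUpperSet_newtonDiagram S ⟨h, h2⟩ hxS
      · have ht : z.1 / x ≤ 1 := (div_le_one hx).2 h.le
        refine isUpperSet_newtonDiagram S ?_ (convex_newtonDiagram S hyS hxS (sub_nonneg.2 ht)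
          (div_nonneg h1 hx.le) (by ring))
        refine ⟨by simp [hx.ne'], ?_⟩
        simp only [Prod.snd_add, Prod.smul_snd, smul_eq_mul, mul_zero, add_zero]
        rw [← mul_le_mul_iff_right₀ hx]
        have : x * ((1 - z.1 / x) * y) = x * y - y * z.1 := by
          field_simp
        rw [this]
        linarith
    refine ⟨h1, ?_, h2, hlt⟩
    by_contra! hc
    nlinarith [mul_nonneg hx.le h2, mul_le_mul_of_nonneg_left hc hy.le]
  have h := measure_mono (μ := volume) hsub
  rw [volume_trapezoid hx.le hy.le le_rfl] at h
  refine (ENNReal.toReal_mono ENNReal.ofReal_ne_top h).trans_eq ?_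
  rw [ENNReal.toReal_ofReal]
  · ring
  · rw [show 2 * y - y = y by ring]
    positivity

theorem newtonNumber_le_of_isDeformation {a b : ℕ} (ha : 0 < a) (hb : 0 < b) {Δ : Set (ℝ × ℝ)}
    (h : IsDeformation (triangle a b) Δ) : newtonNumber Δ ≤ newtonNumber (triangle a b) := by
  obtain ⟨T, hT, rfl⟩ := h
  rw [newtonNumber_triangle ha hb, addPoints, triangle, newtonDiagram_newtonDiagram_union]
  set S := {latticePoint (a, 0), latticePoint (0, b)} ∪ latticePoint '' (T : Set (ℕ × ℕ)) with hS
  -- Excluding the origin keeps all generators, hence both intercepts, at least `1` away.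
  have hhalf : ∀ z ∈ newtonDiagram S, 1 ≤ z.1 + z.2 := by
    have : newtonDiagram S ⊆ {z | (1 : ℝ) ≤ 1 * z.1 + 1 * z.2} := by
      refine newtonDiagram_subset (convex_setOf_le_linear 1 1 1)
        (isUpperSet_setOf_le_linear zero_le_one zero_le_one 1) ?_
      rintro _ ((rfl | rfl) | ⟨z, hz, rfl⟩)
      · simpa [latticePoint] using Nat.succ_le_of_lt ha
      · simpa [latticePoint] using Nat.succ_le_of_lt hb
      · have : 1 ≤ z.1 + z.2 := by
          by_contra! hc
          have : z = (0, 0) := Prod.ext (by simp; omega) (by simp; omega)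
          exact hT (this ▸ hz)
        simp only [latticePoint, Set.mem_ofPred_eq, one_mul]
        exact_mod_cast this
    intro z hz
    simpa using this hz
  have haS : ((a : ℝ), (0 : ℝ)) ∈ newtonDiagram S :=
    subset_newtonDiagram S (by simp [hS, latticePoint])
  have hbS : ((0 : ℝ), (b : ℝ)) ∈ newtonDiagram S :=
    subset_newtonDiagram S (by simp [hS, latticePoint])
  set p := sInf {x : ℝ | (x, (0 : ℝ)) ∈ newtonDiagram S} with hp
  set q := sInf {y : ℝ | ((0 : ℝ), y) ∈ newtonDiagram S} with hq
  have hx1 : ∀ x ∈ {x : ℝ | (x, (0 : ℝ)) ∈ newtonDiagram S}, 1 ≤ x :=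
    fun x hx => by simpa using hhalf _ hx
  have hy1 : ∀ y ∈ {y : ℝ | ((0 : ℝ), y) ∈ newtonDiagram S}, 1 ≤ y :=
    fun y hy => by simpa using hhalf _ hy
  have hp1 : 1 ≤ p := le_csInf ⟨_, haS⟩ hx1
  have hq1 : 1 ≤ q := le_csInf ⟨_, hbS⟩ hy1
  have hpa : p ≤ a := csInf_le ⟨1, hx1⟩ haS
  have hqb : q ≤ b := csInf_le ⟨1, hy1⟩ hbS
  have harea : 2 * (volume (quadrant \ newtonDiagram S)).toReal ≤ p * q := by
    set V := 2 * (volume (quadrant \ newtonDiagram S)).toReal with hV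
    -- The infima are not known to be attained, so the area bound is proved for actual axis points
    -- and passed to the infimum one coordinate at a time.
    have h1 : ∀ y, ((0 : ℝ), y) ∈ newtonDiagram S → V ≤ p * y := by
      intro y hy
      have hy0 : 0 < y := zero_lt_one.trans_le (hy1 y hy)
      rw [← div_le_iff₀ hy0]
      refine le_csInf ⟨_, haS⟩ fun x hx => ?_
      rw [div_le_iff₀ hy0]
      have := volume_quadrant_diff_le (zero_lt_one.trans_le (hx1 x hx)) hy0 hx hy
      linarith
    have hp0 : 0 < p := by linarith
    rw [← div_le_iff₀' hp0]
    refine le_csInf ⟨_, hbS⟩ fun y hy => ?_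
    rw [div_le_iff₀' hp0]
    exact h1 y hy
  have hprod : (p - 1) * (q - 1) ≤ (a - 1) * (b - 1) :=
    mul_le_mul (by linarith) (by linarith) (by linarith) (by linarith)
  rw [newtonNumber, ← hp, ← hq]
  linarith

end NewtonJumps

/-! ### The main theorem -/

theorem theorem1 (a₀ b₀ : ℕ) (ha : 1 < a₀) (hab : a₀ < b₀) (hcop : Nat.Coprime a₀ b₀)
    (r : ℕ) (hr : r = b₀ % a₀) :
    (∃ l : List ℤ, NewtonJumps.IsNewtonSequence (NewtonJumps.triangle a₀ b₀) l ∧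
      (∃ ν₀ : ℤ, l.head? = some ν₀ ∧
        (ν₀ : ℝ) = NewtonJumps.newtonNumber (NewtonJumps.triangle a₀ b₀)) ∧
      List.replicate (r * (a₀ - r)) (1 : ℤ) <+: NewtonJumps.jumps l) ∧
    (∀ k : ℤ,
      NewtonJumps.newtonNumber (NewtonJumps.triangle a₀ b₀) - (r : ℝ) * ((a₀ : ℝ) - (r : ℝ)) ≤ k →
      (k : ℝ) ≤ NewtonJumps.newtonNumber (NewtonJumps.triangle a₀ b₀) →
      ∃ Δ, NewtonJumps.IsDeformation (NewtonJumps.triangle a₀ b₀) Δ ∧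
        NewtonJumps.newtonNumber Δ = (k : ℝ)) := by
  open NewtonJumps in
  have hra : r < a₀ := hr ▸ Nat.mod_lt _ (by omega)
  obtain ⟨m, hm, hb⟩ : ∃ m, 1 ≤ m ∧ b₀ = a₀ * m + r :=
    ⟨b₀ / a₀, (Nat.one_le_div_iff (by omega)).2 hab.le, by rw [hr, Nat.div_add_mod]⟩
  have hcop' : Nat.Coprime a₀ r := by simpa [hb] using hcop
  have hr0 : r ≠ 0 := by
    rintro rfl
    simp at hcop'
    omega
  have hcast : ((r * (a₀ - r) : ℕ) : ℝ) = (r : ℝ) * ((a₀ : ℝ) - r) := by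
    rw [Nat.cast_mul, Nat.cast_sub hra.le]
  have hν := newtonNumber_triangle (a := a₀) (b := b₀) (by omega) (by omega)
  obtain ⟨N, hN⟩ : ∃ N : ℤ, N = (a₀ : ℤ) * b₀ - a₀ - b₀ + 1 := ⟨_, rfl⟩
  have hNν : (N : ℝ) = newtonNumber (triangle a₀ b₀) := by
    rw [hν, hN]
    push_cast
    ring
  have hdef : ∀ i : ℕ, i ≤ r * (a₀ - r) → ∃ Δ, IsDeformation (triangle a₀ b₀) Δ ∧
      newtonNumber Δ = ((N - i : ℤ) : ℝ) := by
    intro i hi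
    obtain ⟨L, hL, hs, hd, hstrict⟩ := exists_strict_chain hm hra.le hcop' hi
    refine ⟨chainDiagram L, ?_, ?_⟩
    · have := isDeformation_chainDiagram hL hstrict (by rw [hs]; simp; omega)
      rwa [hs, ← hb] at this
    · rw [newtonNumber_chainDiagram hL hstrict, hs, ← hb, hd, hN]
      push_cast
      ring
  refine ⟨?_, ?_⟩
  · have hle : ∀ k ∈ attainedNumbers (triangle a₀ b₀), k ≤ N := by
      rintro k ⟨-, Δ, hΔ, hk⟩
      have := newtonNumber_le_of_isDeformation (by omega) (by omega) hΔ
      rw [hk, ← hNν] at this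
      exact_mod_cast this
    have hfin : (attainedNumbers (triangle a₀ b₀)).Finite :=
      (Set.finite_Icc (1 : ℤ) N).subset fun k hk => ⟨hk.1, hle k hk⟩
    have hmem : ∀ k, k ∈ hfin.toFinset.sort (· ≥ ·) ↔ k ∈ attainedNumbers (triangle a₀ b₀) := by
      simp
    have hsort : (hfin.toFinset.sort (· ≥ ·)).Pairwise (· > ·) :=
      (Finset.sortedGT_sort _).pairwise
    -- Since `b₀ ≥ a₀ + r`, the difference `N - r(a₀ - r)` is at least `(a₀ - 1)² + r(r - 1) > 0`,
    -- so all these values count as attained positive integers.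
    have hpos : ∀ i : ℕ, i ≤ r * (a₀ - r) → 0 < N - i := by
      intro i hi
      have hi' : (i : ℤ) ≤ r * (a₀ - r) := by
        zify [hra.le] at hi
        exact hi
      have hb' : (b₀ : ℤ) = a₀ * m + r := by rw [hb]; push_cast; ring
      have hr1 : (1 : ℤ) ≤ r := by omega
      have hm1 : (1 : ℤ) ≤ m := by omega
      have ha1 : (2 : ℤ) ≤ a₀ := by omega
      have hba : (a₀ : ℤ) + r ≤ b₀ := by rw [hb']; nlinarith
      rw [hN]
      nlinarith [mul_nonneg (show (0 : ℤ) ≤ a₀ - 1 by omega) (show (0 : ℤ) ≤ b₀ - a₀ - r by omega),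
        mul_nonneg (show (0 : ℤ) ≤ r by omega) (show (0 : ℤ) ≤ r - 1 by omega)]
    obtain ⟨h1, h2⟩ := replicate_one_prefix_jumps (r * (a₀ - r)) N _ hsort
      (fun k hk => hle k ((hmem k).1 hk)) (fun i hi => (hmem _).2 ⟨hpos i hi, hdef i hi⟩)
    exact ⟨_, ⟨hsort, hmem⟩, ⟨N, h1, hNν⟩, h2⟩
  · intro k hk1 hk2
    rw [← hNν, ← hcast] at hk1
    rw [← hNν] at hk2
    have hk1' : N - (r * (a₀ - r) : ℕ) ≤ k := by exact_mod_cast hk1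
    have hk2' : k ≤ N := by exact_mod_cast hk2
    obtain ⟨i, hi⟩ := Int.eq_ofNat_of_zero_le (show 0 ≤ N - k by omega)
    obtain ⟨Δ, hΔ, h⟩ := hdef i (by omega)
    refine ⟨Δ, hΔ, ?_⟩
    rw [h, ← hi, sub_sub_cancel]
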